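/- Consider the $M|G|\infty$ queue with catastrophes: customers arrive in a Poisson process of rate $\lambda\ge 0$, catastrophes occur in a Poisson process of rate $\nu\ge 0$, there are infinitely many servers, each arriving customer is served immediately, the service times are i.i.d. nonnegative random variables with distribution function $B$ and finite mean, and arrivals, service times and catastrophes are independent. A catastrophe instantly removes all customers present. At time $0$ the system is empty. Let $N(t)$ be the number of busy servers at time $t$. Fix an observation time $T\ge 0$. For $0\le t\le T$ let $N_T(t)$ be the number of servers busy at time $t$ with a customer whose service extends beyond time $T$ (so that, barring later catastrophes, this customer is still in the system at time $T$), and let $P_n(t)=P\{N_T(t)=n\mid N(0)=0\}$, $n\ge 0$. Then each $P_n$ is continuous on $[0,T]$, and the functions $P_n$ satisfy $$\frac{d}{dt}P_0(t)=-[\lambda(1-B(T-t))+\nu]P_0(t)+\nu,$$ $$\frac{d}{dt}P_n(t)=-[\lambda(1-B(T-t))+\nu]P_n(t)+\lambda(1-B(T-t))P_{n-1}(t),\qquad n\ge 1,$$ with $P_0(0)=1$ and $P_n(0)=0$ for $n\ge 1$. Here the equations hold for the derivative on $[0,T]$ (one-sided at the end points) at every $t\in[0,T]$ such that $B$ is continuous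 at $T-t$, and they hold for the left derivative at every $t\in(0,T]$. Moreover, at $t=T$ one obtains the law of the number of busy servers: $P_n(T)=P\{N(T)=n\mid N(0)=0\}$ for all $n\ge 0$. -/

import Mathlib

open MeasureTheory ProbabilityTheory Set
open scoped NNReal

namespace CatastropheQueue

/-- `X` is a (homogeneous) Poisson process of rate `r`: its paths are counting functions (starting
at `0`, nondecreasing, right-continuous, `ℕ`-valued), its increments are independent, and the
increment over `(s, t]` has the Poisson distribution with parameter `r (t - s)`. -/
structure IsPoissonProcess {Ω : Type*} [MeasurableSpace Ω]
    (X : ℝ≥0 → Ω → ℕ) (r : ℝ≥0) (P : Measure Ω) : Prop where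
  measurable : ∀ t, Measurable (X t)
  zero : ∀ ω, X 0 ω = 0
  mono : ∀ ω, Monotone fun t => X t ω
  rightCont : ∀ ω t, ContinuousWithinAt (fun s => X s ω) (Ici t) t
  indepIncrements : HasIndepIncrements X P
  law : ∀ s t, s ≤ t → HasLaw (fun ω => X t ω - X s ω) (poissonMeasure (r * (t - s))) P

/-- The probabilistic data of the queue: customers arrive according to the Poisson process `X` of
rate `lam`, catastrophes occur according to the Poisson process `Y` of rate `nu`, the `i`-th customer
(counted from `0`) brings the service time `β i`, the service times are i.i.d. nonnegative with law
`μ` of finite mean, and arrivals, service times and catastrophes are mutually independent. -/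
structure IsModel {Ω : Type*} [MeasurableSpace Ω]
    (X : ℝ≥0 → Ω → ℕ) (β : ℕ → Ω → ℝ) (Y : ℝ≥0 → Ω → ℕ)
    (lam nu : ℝ≥0) (μ : Measure ℝ) (P : Measure Ω) : Prop where
  arrivals : IsPoissonProcess X lam P
  catastrophes : IsPoissonProcess Y nu P
  service_measurable : ∀ i, Measurable (β i)
  service_nonneg : ∀ i, ∀ᵐ ω ∂P, 0 ≤ β i ω
  service_law : ∀ i, HasLaw (β i) μ P
  service_indep : iIndepFun β P
  service_mean : Integrable id μ
  indep_arrivals : IndepFun (fun ω t => X t ω) (fun ω => ((fun i => β i ω), (fun t => Y t ω))) P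
  indep_service : IndepFun (fun ω i => β i ω) (fun ω t => Y t ω) P

variable {Ω : Type*}

/-- Arrival epoch of the `i`-th customer (counted from `0`). It is used only for customers that have
arrived, so that the set below is nonempty and contains its infimum. -/
noncomputable def arrivalTime (X : ℝ≥0 → Ω → ℕ) (i : ℕ) (ω : Ω) : ℝ≥0 :=
  sInf {t | i < X t ω}

open Classical in
/-- The customers in the system at time `t`: those that have arrived by time `t`, whose service is
not completed at time `t`, and since whose arrival no catastrophe has occurred up to time `t`.
The system is empty at time `0`. -/
noncomputable def customers (X : ℝ≥0 → Ω → ℕ) (β : ℕ → Ω → ℝ) (Y : ℝ≥0 → Ω → ℕ)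
    (t : ℝ≥0) (ω : Ω) : Finset ℕ :=
  (Finset.range (X t ω)).filter fun i =>
    (t : ℝ) < arrivalTime X i ω + β i ω ∧ Y t ω = Y (arrivalTime X i ω) ω

/-- `N(t)`, the number of customers in the system (equivalently, of busy servers) at time `t`. -/
noncomputable def numBusy (X : ℝ≥0 → Ω → ℕ) (β : ℕ → Ω → ℝ) (Y : ℝ≥0 → Ω → ℕ)
    (t : ℝ≥0) (ω : Ω) : ℕ :=
  (customers X β Y t ω).card

open Classical in
/-- `N_T(t)`, the number of servers busy at time `t` with a customer whose service extends beyond the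
observation time `T` (so that, barring later catastrophes, the server is still busy with that
customer at time `T`). -/
noncomputable def numBusyUntil (X : ℝ≥0 → Ω → ℕ) (β : ℕ → Ω → ℝ) (Y : ℝ≥0 → Ω → ℕ)
    (T t : ℝ≥0) (ω : Ω) : ℕ :=
  ((customers X β Y t ω).filter fun i => (T : ℝ) < arrivalTime X i ω + β i ω).card

/-- `P_n(t)` for the observation time `T`: the conditional probability of `N_T(t) = n`, given that
the system is empty at time `0`. -/
noncomputable def busyProb [MeasurableSpace Ω] (P : Measure Ω)
    (X : ℝ≥0 → Ω → ℕ) (β : ℕ → Ω → ℝ) (Y : ℝ≥0 → Ω → ℕ) (T : ℝ≥0) (n : ℕ) (t : ℝ) : ℝ :=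
  (cond P {ω | numBusy X β Y 0 ω = 0}).real {ω | numBusyUntil X β Y T t.toNNReal ω = n}

/-- The right-hand side of the Kolmogorov equations, at service survival probability `S`, for a
sequence `p` of state probabilities. -/
def kolmogorovRHS (lam nu S : ℝ) (p : ℕ → ℝ) : ℕ → ℝ
  | 0 => -(lam * S + nu) * p 0 + nu
  | n + 1 => -(lam * S + nu) * p (n + 1) + lam * S * p n

end CatastropheQueue

/-! Because `T` is fixed, whether a customer is counted by `numBusyUntil` is settled by arrival
epoch and service time. The count on `[0, T]` changes only at arrivals and catastrophes, never by a
service completion. Put `h = t - s` and split according to the events in `(s, t]`. With no event the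
count is kept. With catastrophes but no arrival it becomes `0`. With one arrival and no catastrophe
it grows by one exactly when the new service time exceeds `T` minus the arrival epoch. All other
cases have total probability of order `h ^ 2`. The arrival epoch lies in `[s, t]`, so replacing the
threshold by any fixed `c` between `T - t` and `T - s` costs at most `lam * h * (F (T - s) - F (T -
t))`, with `F = cdf μ`. The probabilities factor because the count at `s` depends only on the past
of `X` and `Y` and on the service times of customers who have already arrived
(`IsModel.measureReal_joint`). The outcome is the uniform expansion `IsModel.abs_increment_sub_le`.
The rest is calculus. The expansion makes each state probability Lipschitz. Right-continuity of `F`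
makes the error vanish for left derivatives; right derivatives need continuity of `F` at `T - t`. -/

namespace CatastropheQueue

/-! ### Regrouping of independent σ-algebras; the past of a Poisson process against its next
increment. -/

section Independence

variable {Ω : Type*}

lemma isPiSystem_image2_inter (m₁ m₂ : MeasurableSpace Ω) :
    IsPiSystem (image2 (· ∩ ·) {s | MeasurableSet[m₁] s} {s | MeasurableSet[m₂] s}) := by
  rintro _ ⟨a, ha, b, hb, rfl⟩ _ ⟨a', ha', b', hb', rfl⟩ -
  exact ⟨a ∩ a', MeasurableSet.inter ha ha', b ∩ b', MeasurableSet.inter hb hb',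
    inter_inter_inter_comm ..⟩

lemma sup_eq_generateFrom_image2_inter (m₁ m₂ : MeasurableSpace Ω) :
    m₁ ⊔ m₂ = MeasurableSpace.generateFrom
      (image2 (· ∩ ·) {s | MeasurableSet[m₁] s} {s | MeasurableSet[m₂] s}) := by
  apply le_antisymm
  · refine sup_le (fun s hs => ?_) (fun s hs => ?_)
    · exact MeasurableSpace.measurableSet_generateFrom
        ⟨s, hs, univ, MeasurableSet.univ, inter_univ s⟩
    · exact MeasurableSpace.measurableSet_generateFrom
        ⟨univ, MeasurableSet.univ, s, hs, univ_inter s⟩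
  · apply MeasurableSpace.generateFrom_le
    rintro _ ⟨a, ha, b, hb, rfl⟩
    exact MeasurableSet.inter (le_sup_left (a := m₁) a ha) (le_sup_right (a := m₁) b hb)

/-- Two independent pairs, each with independent components, may be regrouped componentwise. -/
lemma indep_sup_sup {m₀ : MeasurableSpace Ω} {P : Measure Ω} [IsProbabilityMeasure P]
    {m₁ m₁' m₂ m₂' : MeasurableSpace Ω}
    (h₁ : m₁ ≤ m₀) (h₁' : m₁' ≤ m₀) (h₂ : m₂ ≤ m₀) (h₂' : m₂' ≤ m₀)
    (h : Indep (m₁ ⊔ m₁') (m₂ ⊔ m₂') P) (hi₁ : Indep m₁ m₁' P) (hi₂ : Indep m₂ m₂' P) :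
    Indep (m₁ ⊔ m₂) (m₁' ⊔ m₂') P := by
  refine IndepSets.indep (sup_le h₁ h₂) (sup_le h₁' h₂') (isPiSystem_image2_inter m₁ m₂)
    (isPiSystem_image2_inter m₁' m₂') (sup_eq_generateFrom_image2_inter _ _)
    (sup_eq_generateFrom_image2_inter _ _) ?_
  rw [IndepSets_iff]
  rintro _ _ ⟨a, ha, b, hb, rfl⟩ ⟨a', ha', b', hb', rfl⟩
  rw [Indep_iff] at h hi₁ hi₂
  have l₁ := le_sup_left (a := m₁) (b := m₁')
  have r₁ := le_sup_right (a := m₁) (b := m₁')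
  have l₂ := le_sup_left (a := m₂) (b := m₂')
  have r₂ := le_sup_right (a := m₂) (b := m₂')
  rw [inter_inter_inter_comm,
    h _ _ (MeasurableSet.inter (l₁ a ha) (r₁ a' ha')) (MeasurableSet.inter (l₂ b hb) (r₂ b' hb')),
    hi₁ a a' ha ha', hi₂ b b' hb hb', h a b (l₁ a ha) (l₂ b hb), h a' b' (r₁ a' ha') (r₂ b' hb')]
  ring

variable [MeasurableSpace Ω] {P : Measure Ω} {X : ℝ≥0 → Ω → ℕ} {r : ℝ≥0}

/-- Along an increasing sequence of times starting at `0`, the values of a Poisson process up to the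
`n`-th time are independent of the next increment. -/
lemma IsPoissonProcess.indep_nat [IsProbabilityMeasure P] (hX : IsPoissonProcess X r P)
    {τ : ℕ → ℝ≥0} (hτ : Monotone τ) (h0 : τ 0 = 0) (n : ℕ) :
    Indep (⨆ k ∈ Iic n, MeasurableSpace.comap (X (τ k)) inferInstance)
      (MeasurableSpace.comap (fun ω => X (τ (n + 1)) ω - X (τ n) ω) inferInstance) P := by
  let I : ℕ → Ω → ℕ := fun k ω => X (τ (k + 1)) ω - X (τ k) ω
  have hI : ∀ k, Measurable (I k) := fun k => (hX.measurable _).sub (hX.measurable _)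
  have key := indep_iSup_of_disjoint (fun k => (hI k).comap_le)
    (hX.indepIncrements.nat hτ).iIndep (S := Iio n) (T := {n}) (by simp)
  simp only [mem_singleton_iff, iSup_iSup_eq_left] at key
  refine indep_of_indep_of_le_left key (iSup₂_le fun k hk => ?_)
  rw [← measurable_iff_comap_le]
  -- The increments telescope from `X 0 = 0`; monotone paths keep the truncated subtraction exact.
  have hsum : ∀ k, X (τ k) = fun ω => ∑ j ∈ Finset.range k, I j ω := by
    intro k
    funext ω
    induction k with
    | zero => simp [h0, hX.zero]
    | succ k ih =>
      rw [Finset.sum_range_succ, ← ih]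
      have : X (τ k) ω ≤ X (τ (k + 1)) ω := hX.mono ω (hτ k.le_succ)
      simp only [I]
      omega
  rw [hsum k]
  refine @Finset.measurable_sum _ _ _ _ _ _ (_) _ _ fun j hj => ?_
  rw [measurable_iff_comap_le]
  exact le_iSup₂_of_le (f := fun i (_ : i ∈ Iio n) => MeasurableSpace.comap (I i) inferInstance) j
    (lt_of_lt_of_le (Finset.mem_range.1 hj) hk) le_rfl

lemma IsPoissonProcess.indep_finset [IsProbabilityMeasure P] (hX : IsPoissonProcess X r P)
    {s t : ℝ≥0} (hst : s ≤ t) (J : Finset ℝ≥0) (hJ : ∀ u ∈ J, u ≤ s) :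
    Indep (⨆ u ∈ J, MeasurableSpace.comap (X u) inferInstance)
      (MeasurableSpace.comap (fun ω => X t ω - X s ω) inferInstance) P := by
  classical
  -- Adding `0` and `s` makes the increasing enumeration of `K` start at `0` and end at `s`.
  -- Extending it by the constant `t` makes the step after index `K.card - 1` the increment over
  -- `(s, t]`.
  let K : Finset ℝ≥0 := insert 0 (insert s J)
  have hK : ∀ u ∈ K, u ≤ s := by
    intro u hu
    simp only [K, Finset.mem_insert] at hu
    rcases hu with rfl | rfl | hu
    · exact zero_le
    · exact le_rfl
    · exact hJ u hu
  have hcard : 0 < K.card := Finset.card_pos.2 ⟨0, by simp [K]⟩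
  let e := K.orderEmbOfFin rfl
  let τ : ℕ → ℝ≥0 := fun i => if h : i < K.card then e ⟨i, h⟩ else t
  have heK : ∀ i, e i ∈ K := fun i => K.orderEmbOfFin_mem rfl i
  have hsurj : ∀ u ∈ K, ∃ i, e i = u := by
    intro u hu
    have : u ∈ Set.range e := by rw [Finset.range_orderEmbOfFin]; exact hu
    exact this
  have hτ : Monotone τ := by
    intro i j hij
    by_cases hj : j < K.card
    · have hi : i < K.card := lt_of_le_of_lt hij hj
      simp only [τ, hi, hj, dif_pos]
      exact e.monotone hij
    · by_cases hi : i < K.card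
      · simp only [τ, hi, hj, dif_pos, dif_neg, not_false_iff]
        exact (hK _ (heK _)).trans hst
      · simp [τ, hi, hj]
  have h0 : τ 0 = 0 := by
    obtain ⟨i, hi⟩ := hsurj 0 (by simp [K])
    have : τ 0 ≤ τ i := hτ (Nat.zero_le _)
    simp only [τ, i.2, dif_pos, hi] at this ⊢
    simpa using this
  have hs : τ (K.card - 1) = s := by
    obtain ⟨i, hi⟩ := hsurj s (by simp [K])
    have h1 : τ i ≤ τ (K.card - 1) := hτ (by omega)
    have h2 : K.card - 1 < K.card := by omega
    simp only [τ, i.2, h2, dif_pos, hi] at h1 ⊢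
    exact le_antisymm (hK _ (heK _)) h1
  have ht : τ (K.card - 1 + 1) = t := by
    have : ¬ (K.card - 1 + 1 < K.card) := by omega
    simp only [τ, this, dif_neg, not_false_iff]
  have key := hX.indep_nat hτ h0 (K.card - 1)
  rw [hs, ht] at key
  refine indep_of_indep_of_le_left key (iSup₂_le fun u hu => ?_)
  obtain ⟨i, hi⟩ := hsurj u (by simp [K, hu])
  have : τ i = u := by simp only [τ, i.2, dif_pos, hi]
  rw [← this]
  exact le_iSup₂_of_le (f := fun k (_ : k ∈ Iic (K.card - 1)) =>
    MeasurableSpace.comap (X (τ k)) inferInstance) i (by simp only [mem_Iic]; omega) le_rfl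

/-- The past of a Poisson process up to time `s` is independent of its increment over `(s, t]`. -/
lemma IsPoissonProcess.indep_past [IsProbabilityMeasure P] (hX : IsPoissonProcess X r P)
    {s t : ℝ≥0} (hst : s ≤ t) :
    Indep (⨆ u : Iic s, MeasurableSpace.comap (X u) inferInstance)
      (MeasurableSpace.comap (fun ω => X t ω - X s ω) inferInstance) P := by
  classical
  -- The uncountable past is the directed supremum of its finite subfamilies, and independence
  -- passes to directed suprema.
  rw [iSup_eq_iSup_finset]
  refine indep_iSup_of_directed_le (fun J => ?_) (fun J => ?_) ?_ ?_
  · refine indep_of_indep_of_le_left (hX.indep_finset hst (J.map (Function.Embedding.subtype _))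
      (by simp +contextual)) (iSup₂_le fun u hu => ?_)
    exact le_iSup₂_of_le (f := fun v (_ : v ∈ J.map (Function.Embedding.subtype _)) =>
      MeasurableSpace.comap (X v) inferInstance) u.1 (Finset.mem_map_of_mem _ hu) le_rfl
  · exact iSup₂_le fun u _ => (hX.measurable u).comap_le
  · exact ((hX.measurable t).sub (hX.measurable s)).comap_le
  · refine Monotone.directed_le fun J J' h => ?_
    exact biSup_mono fun u hu => h hu

end Independence

/-! ### Pathwise behaviour of the count, and its measurability with respect to the history. -/

section Paths

variable {Ω : Type*} {X Y : ℝ≥0 → Ω → ℕ} {β : ℕ → Ω → ℝ} {ω : Ω} {i : ℕ} {q s t T : ℝ≥0}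

lemma arrivalTime_le (h : i < X t ω) : arrivalTime X i ω ≤ t :=
  csInf_le (OrderBot.bddBelow _) h

/-- `hi` excludes the empty set, whose infimum in `ℝ≥0` is `0`. -/
lemma le_arrivalTime (hX : Monotone fun u => X u ω) (hi : i < X s ω) (hq : X q ω ≤ i) :
    q ≤ arrivalTime X i ω := by
  refine le_csInf ⟨s, hi⟩ fun u hu => ?_
  by_contra! h
  exact absurd (hX h.le) (not_le.2 (lt_of_le_of_lt hq hu))

lemma lt_of_arrivalTime_lt (hX : Monotone fun u => X u ω) (hi : i < X s ω)
    (hq : arrivalTime X i ω < q) : i < X q ω := by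
  by_contra! h
  exact absurd (le_arrivalTime hX hi h) (not_le.2 hq)

/-- The customers counted by `numBusyUntil`, for `t ≤ T`. -/
lemma numBusyUntil_eq (htT : t ≤ T) [DecidablePred fun i =>
      (T : ℝ) < arrivalTime X i ω + β i ω ∧ Y t ω = Y (arrivalTime X i ω) ω] :
    numBusyUntil X β Y T t ω = ((Finset.range (X t ω)).filter fun i =>
      (T : ℝ) < arrivalTime X i ω + β i ω ∧ Y t ω = Y (arrivalTime X i ω) ω).card := by
  unfold numBusyUntil customers
  congr 1
  ext i
  have : (t : ℝ) ≤ T := by exact_mod_cast htT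
  simp only [Finset.mem_filter, Finset.mem_range]
  constructor
  · rintro ⟨⟨h1, -, h3⟩, h4⟩
    exact ⟨h1, h4, h3⟩
  · rintro ⟨h1, h4, h3⟩
    exact ⟨⟨h1, by linarith, h3⟩, h4⟩

lemma numBusyUntil_self : numBusyUntil X β Y T T ω = numBusy X β Y T ω := by
  unfold numBusyUntil numBusy
  rw [Finset.filter_true_of_mem]
  intro i hi
  simp only [customers, Finset.mem_filter] at hi
  exact hi.2.1

/-- Nothing changes over a time interval without arrivals and catastrophes. -/
lemma numBusyUntil_of_no_event (hst : s ≤ t) (htT : t ≤ T)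
    (hx : X t ω = X s ω) (hy : Y t ω = Y s ω) :
    numBusyUntil X β Y T t ω = numBusyUntil X β Y T s ω := by
  classical
  rw [numBusyUntil_eq htT, numBusyUntil_eq (hst.trans htT), hx, hy]

/-- A time interval with catastrophes but without arrivals leaves the system empty. -/
lemma numBusyUntil_of_catastrophe (hY : Monotone fun u => Y u ω) (htT : t ≤ T)
    (hx : X t ω = X s ω) (hy : Y s ω < Y t ω) : numBusyUntil X β Y T t ω = 0 := by
  classical
  rw [numBusyUntil_eq htT, Finset.card_eq_zero, Finset.filter_eq_empty_iff]
  rintro i hi ⟨-, h⟩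
  rw [Finset.mem_range, hx] at hi
  have := hY (arrivalTime_le hi)
  simp only at this
  omega

/-- A single arrival in a time interval without catastrophes adds one customer, if the service of
that customer extends beyond `T`. -/
lemma numBusyUntil_of_arrival (hX : Monotone fun u => X u ω) (hY : Monotone fun u => Y u ω)
    (hst : s ≤ t) (htT : t ≤ T)
    (hx : X t ω = X s ω + 1) (hy : Y t ω = Y s ω)
    [Decidable ((T : ℝ) < arrivalTime X (X s ω) ω + β (X s ω) ω)] :
    numBusyUntil X β Y T t ω = numBusyUntil X β Y T s ω +
      if (T : ℝ) < arrivalTime X (X s ω) ω + β (X s ω) ω then 1 else 0 := by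
  classical
  have h1 : arrivalTime X (X s ω) ω ≤ t := arrivalTime_le (by omega)
  have h2 : s ≤ arrivalTime X (X s ω) ω := le_arrivalTime (s := t) hX (by omega) le_rfl
  have h3 : Y s ω = Y (arrivalTime X (X s ω) ω) ω :=
    le_antisymm (hY h2) ((hY h1).trans_eq hy)
  rw [numBusyUntil_eq htT, numBusyUntil_eq (hst.trans htT), hx, hy, Finset.range_add_one,
    Finset.filter_insert]
  simp only [← h3, and_true]
  split_ifs with h
  · rw [Finset.card_insert_of_notMem (by simp)]
  · simp

/-- Removes the random epoch in favour of times from a dense set, so that a countable one yields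
measurability. Right-continuity with discrete values keeps `Y` constant just after the arrival, and
a dense time can be chosen there. -/
lemma eq_arrivalTime_iff (hX : Monotone fun u => X u ω) (hY : Monotone fun u => Y u ω)
    (hYc : ∀ t, ContinuousWithinAt (fun s => Y s ω) (Ici t) t)
    {Q : Set ℝ≥0} (hQ : Dense Q) (hi : i < X s ω) :
    Y s ω = Y (arrivalTime X i ω) ω ↔ ∀ q ∈ Q, q < s → i < X q ω → Y q ω = Y s ω := by
  constructor
  · intro h q _ hqs hq
    exact le_antisymm (hY hqs.le) (h.trans_le (hY (arrivalTime_le hq)))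
  · intro h
    rcases (arrivalTime_le hi).eq_or_lt with h1 | h1
    · rw [h1]
    · have h2 := hYc (arrivalTime X i ω)
      have h3 : ∀ᶠ u in nhdsWithin (arrivalTime X i ω) (Ioi (arrivalTime X i ω)),
          Y u ω = Y (arrivalTime X i ω) ω := by
        have h4 := (h2.mono Ioi_subset_Ici_self).eventually
          (show ∀ᶠ n in nhds (Y (arrivalTime X i ω) ω), n = Y (arrivalTime X i ω) ω by
            rw [nhds_discrete]; simp)
        exact h4
      rw [(nhdsGT_basis_of_exists_gt ⟨s, h1⟩).eventually_iff] at h3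
      obtain ⟨v, hv, hv'⟩ := h3
      obtain ⟨q, hq, hq1, hq2⟩ := hQ.exists_between (lt_min hv h1)
      rw [← hv' ⟨hq1, hq2.trans_le (min_le_left _ _)⟩]
      exact (h q hq (hq2.trans_le (min_le_right _ _)) (lt_of_arrivalTime_lt hX hi hq1)).symm

/-- A dense time is squeezed between `T - β i ω` and the arrival epoch. The case `T < β i ω` stands
apart because the epoch may be `0`, with no time below it. -/
lemma lt_arrivalTime_add_iff (hX : Monotone fun u => X u ω)
    {Q : Set ℝ≥0} (hQ : Dense Q) (hi : i < X s ω) :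
    (T : ℝ) < arrivalTime X i ω + β i ω ↔
      (T : ℝ) < β i ω ∨ ∃ q ∈ Q, q ≤ s ∧ X q ω ≤ i ∧ (T : ℝ) < q + β i ω := by
  constructor
  · intro h
    by_cases hT : (T : ℝ) < β i ω
    · exact Or.inl hT
    · right
      push Not at hT
      have h1 : (T - β i ω).toNNReal < arrivalTime X i ω := by
        rw [Real.toNNReal_lt_iff_lt_coe (by linarith)]
        linarith
      obtain ⟨q, hq, hq1, hq2⟩ := hQ.exists_between h1
      refine ⟨q, hq, hq2.le.trans (arrivalTime_le hi), ?_, ?_⟩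
      · by_contra! h2
        exact absurd (arrivalTime_le h2) (not_le.2 hq2)
      · rw [Real.toNNReal_lt_iff_lt_coe (by linarith)] at hq1
        linarith
  · rintro (h | ⟨q, -, -, hq, h⟩)
    · have := (arrivalTime X i ω).coe_nonneg
      linarith
    · have : (q : ℝ) ≤ arrivalTime X i ω := by exact_mod_cast le_arrivalTime hX hi hq
      linarith

/-- The event that `m` customers have arrived and `n` of them are counted by `numBusyUntil` at time
`s` is determined by the arrivals and catastrophes up to time `s` and by the first `m` service
times. -/
lemma measurableSet_numBusyUntil [MeasurableSpace Ω] (hX : ∀ ω, Monotone fun u => X u ω)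
    (hY : ∀ ω, Monotone fun u => Y u ω)
    (hYc : ∀ ω t, ContinuousWithinAt (fun s => Y s ω) (Ici t) t)
    (hsT : s ≤ T) (m n : ℕ) (hXm : ∀ u ≤ s, Measurable (X u)) (hYm : ∀ u ≤ s, Measurable (Y u))
    (hβm : ∀ i < m, Measurable (β i)) :
    MeasurableSet {ω | X s ω = m ∧ numBusyUntil X β Y T s ω = n} := by
  classical
  obtain ⟨Q, hQc, hQ⟩ := TopologicalSpace.exists_countable_dense ℝ≥0
  let C : ℕ → Ω → Prop := fun i ω =>
    ((T : ℝ) < β i ω ∨ ∃ q ∈ Q, q ≤ s ∧ X q ω ≤ i ∧ (T : ℝ) < q + β i ω) ∧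
      ∀ q ∈ Q, q < s → i < X q ω → Y q ω = Y s ω
  have hC : ∀ i < m, MeasurableSet {ω | C i ω} := by
    intro i hi
    refine MeasurableSet.inter (MeasurableSet.union ?_ ?_) ?_
    · exact measurableSet_lt measurable_const (hβm i hi)
    · have : {ω | ∃ q ∈ Q, q ≤ s ∧ X q ω ≤ i ∧ (T : ℝ) < q + β i ω} =
          ⋃ q ∈ Q, {ω | q ≤ s ∧ X q ω ≤ i ∧ (T : ℝ) < q + β i ω} := by
        ext
        simp only [mem_ofPred_eq, mem_iUnion, exists_prop]
      change MeasurableSet {ω | ∃ q ∈ Q, q ≤ s ∧ X q ω ≤ i ∧ (T : ℝ) < q + β i ω}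
      rw [this]
      refine MeasurableSet.biUnion hQc fun q _ => ?_
      by_cases hq : q ≤ s
      · simp only [hq, true_and]
        exact (measurableSet_le (hXm q hq) measurable_const).inter
          (measurableSet_lt measurable_const (measurable_const.add (hβm i hi)))
      · simp [hq]
    · have : {ω | ∀ q ∈ Q, q < s → i < X q ω → Y q ω = Y s ω} =
          ⋂ q ∈ Q, {ω | q < s → i < X q ω → Y q ω = Y s ω} := by
        ext
        simp only [mem_ofPred_eq, mem_iInter]
      change MeasurableSet {ω | ∀ q ∈ Q, q < s → i < X q ω → Y q ω = Y s ω}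
      rw [this]
      refine MeasurableSet.biInter hQc fun q _ => ?_
      by_cases hq : q < s
      · simp only [hq, true_imp_iff]
        exact (measurableSet_lt measurable_const (hXm q hq.le)).imp
          (measurableSet_eq_fun (hYm q hq.le) (hYm s le_rfl))
      · simp [hq]
  have heq : {ω | X s ω = m ∧ numBusyUntil X β Y T s ω = n} =
      {ω | X s ω = m} ∩ {ω | ∑ i ∈ Finset.range m, (if C i ω then 1 else 0) = n} := by
    ext ω
    simp only [mem_ofPred_eq, mem_inter_iff]
    refine and_congr_right fun hm => ?_
    rw [numBusyUntil_eq hsT, hm, Finset.card_filter]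
    refine Eq.congr_left (Finset.sum_congr rfl fun i hi => ?_)
    have hi' : i < X s ω := by rw [hm]; exact Finset.mem_range.1 hi
    simp only [C, lt_arrivalTime_add_iff (hX ω) hQ hi',
      eq_arrivalTime_iff (hX ω) (hY ω) (hYc ω) hQ hi']
  rw [heq]
  refine (measurableSet_eq_fun (hXm s le_rfl) measurable_const).inter
    (measurableSet_eq_fun (Finset.measurable_sum _ fun i hi => ?_) measurable_const)
  exact Measurable.ite (hC i (Finset.mem_range.1 hi)) measurable_const measurable_const

end Paths

/-! ### Independence of the history from the next service time and the increments. -/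

section JointLaw

variable {Ω : Type*} {X Y : ℝ≥0 → Ω → ℕ} {β : ℕ → Ω → ℝ} {lam nu : ℝ≥0} {μ : Measure ℝ} {s t T : ℝ≥0}

lemma comap_apply_le_comap {ι κ : Type*} [MeasurableSpace κ] (Z : ι → Ω → κ) (i : ι) :
    MeasurableSpace.comap (Z i) inferInstance ≤
      MeasurableSpace.comap (fun ω i => Z i ω) MeasurableSpace.pi :=
  measurable_iff_comap_le.1 ((measurable_pi_apply i).comp
    (comap_measurable (m := MeasurableSpace.pi) (fun ω i => Z i ω)))

lemma comap_increment_le_comap (X : ℝ≥0 → Ω → ℕ) (s t : ℝ≥0) :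
    MeasurableSpace.comap (fun ω => X t ω - X s ω) inferInstance ≤
      MeasurableSpace.comap (fun ω t => X t ω) MeasurableSpace.pi := by
  rw [← measurable_iff_comap_le]
  exact Measurable.sub (measurable_iff_comap_le.2 (comap_apply_le_comap X t))
    (measurable_iff_comap_le.2 (comap_apply_le_comap X s))

variable [MeasurableSpace Ω] {P : Measure Ω}

/-- Freezing `X s = m` confines the event to the service times with index below `m`, leaving `β m`
available as an independent variable. -/
lemma IsModel.measurableSet_history (hM : IsModel X β Y lam nu μ P) (hsT : s ≤ T) (m : ℕ) (d : Set ℕ) :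
    MeasurableSet[(⨆ u : Iic s, MeasurableSpace.comap (X u) inferInstance) ⊔
      ((⨆ i ∈ Iio m, MeasurableSpace.comap (β i) inferInstance) ⊔
        ⨆ u : Iic s, MeasurableSpace.comap (Y u) inferInstance)]
      {ω | X s ω = m ∧ numBusyUntil X β Y T s ω ∈ d} := by
  have hd : {ω | X s ω = m ∧ numBusyUntil X β Y T s ω ∈ d} =
      ⋃ n ∈ d, {ω | X s ω = m ∧ numBusyUntil X β Y T s ω = n} := by
    ext ω
    simp only [mem_ofPred_eq, mem_iUnion, exists_prop]
    exact ⟨fun h => ⟨_, h.2, h.1, rfl⟩, fun ⟨n, hn, h⟩ => ⟨h.1, h.2 ▸ hn⟩⟩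
  rw [hd]
  refine MeasurableSet.biUnion d.to_countable fun n _ => ?_
  -- The measurable structure on `Ω` here is the history σ-algebra, not the ambient one.
  refine @measurableSet_numBusyUntil Ω X Y β s T (_) hM.arrivals.mono hM.catastrophes.mono
    hM.catastrophes.rightCont hsT m n (fun u hu => ?_) (fun u hu => ?_) (fun i hi => ?_)
  · exact measurable_iff_comap_le.2 (le_sup_of_le_left
      (le_iSup (fun u : Iic s => MeasurableSpace.comap (X u) inferInstance) ⟨u, hu⟩))
  · exact measurable_iff_comap_le.2 (le_sup_of_le_right (le_sup_of_le_right
      (le_iSup (fun u : Iic s => MeasurableSpace.comap (Y u) inferInstance) ⟨u, hu⟩)))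
  · exact measurable_iff_comap_le.2 (le_sup_of_le_right (le_sup_of_le_left
      (le_iSup₂ (f := fun i (_ : i ∈ Iio m) => MeasurableSpace.comap (β i) inferInstance) i hi)))

lemma IsModel.measurable_numBusyUntil (hM : IsModel X β Y lam nu μ P) (hsT : s ≤ T) :
    Measurable (numBusyUntil X β Y T s) := by
  refine measurable_to_countable' fun n => ?_
  have : numBusyUntil X β Y T s ⁻¹' {n} =
      ⋃ m, {ω | X s ω = m ∧ numBusyUntil X β Y T s ω = n} := by
    ext ω
    simp only [mem_preimage, mem_singleton_iff, mem_iUnion, mem_ofPred_eq, exists_eq_left']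
  rw [this]
  exact MeasurableSet.iUnion fun m => measurableSet_numBusyUntil hM.arrivals.mono
    hM.catastrophes.mono hM.catastrophes.rightCont hsT m n
    (fun u _ => hM.arrivals.measurable u) (fun u _ => hM.catastrophes.measurable u)
    fun i _ => hM.service_measurable i

/-- The service time of the first customer to arrive after time `s` is measurable. -/
lemma IsModel.measurable_nextService (hM : IsModel X β Y lam nu μ P) (s : ℝ≥0) :
    Measurable fun ω => β (X s ω) ω :=
  (measurable_from_prod_countable_right (f := fun p : ℕ × Ω => β p.1 p.2)
    hM.service_measurable).comp ((hM.arrivals.measurable s).prodMk measurable_id)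

variable [IsProbabilityMeasure P]

/-- The history consisting of the arrivals and catastrophes up to time `s` and of the first `m`
service times is independent of the next service time and of the numbers of arrivals and
catastrophes in `(s, t]`, and these three are independent of each other. -/
lemma IsModel.measure_history_inter (hM : IsModel X β Y lam nu μ P) (hst : s ≤ t) (m : ℕ)
    {E : Set Ω}
    (hE : MeasurableSet[(⨆ u : Iic s, MeasurableSpace.comap (X u) inferInstance) ⊔
      ((⨆ i ∈ Iio m, MeasurableSpace.comap (β i) inferInstance) ⊔
        ⨆ u : Iic s, MeasurableSpace.comap (Y u) inferInstance)] E)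
    (a b : Set ℕ) {D : Set ℝ} (hD : MeasurableSet D) :
    P (E ∩ ({ω | X t ω - X s ω ∈ a} ∩ ({ω | β m ω ∈ D} ∩ {ω | Y t ω - Y s ω ∈ b}))) =
      P E * (poissonMeasure (lam * (t - s)) a * (μ D * poissonMeasure (nu * (t - s)) b)) := by
  have hXle : (⨆ u : Iic s, MeasurableSpace.comap (X u) inferInstance) ≤
      MeasurableSpace.comap (fun ω t => X t ω) MeasurableSpace.pi :=
    iSup_le fun u => comap_apply_le_comap X u
  have hYle : (⨆ u : Iic s, MeasurableSpace.comap (Y u) inferInstance) ≤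
      MeasurableSpace.comap (fun ω t => Y t ω) MeasurableSpace.pi :=
    iSup_le fun u => comap_apply_le_comap Y u
  have hβle : (⨆ i ∈ Iio m, MeasurableSpace.comap (β i) inferInstance) ≤
      MeasurableSpace.comap (fun ω i => β i ω) MeasurableSpace.pi :=
    iSup₂_le fun i _ => comap_apply_le_comap β i
  have hX₀ := (measurable_pi_lambda (fun ω t => X t ω) hM.arrivals.measurable).comap_le
  have hY₀ := (measurable_pi_lambda (fun ω t => Y t ω) hM.catastrophes.measurable).comap_le
  have hβ₀ := (measurable_pi_lambda (fun ω i => β i ω) hM.service_measurable).comap_le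
  have hDX := comap_increment_le_comap X s t
  have hDY := comap_increment_le_comap Y s t
  have hβm := comap_apply_le_comap β m
  have hββ : Indep (⨆ i ∈ Iio m, MeasurableSpace.comap (β i) inferInstance)
      (MeasurableSpace.comap (β m) inferInstance) P := by
    have := indep_iSup_of_disjoint (fun k => (hM.service_measurable k).comap_le)
      hM.service_indep.iIndep (S := Iio m) (T := {m}) (by simp)
    simpa only [mem_singleton_iff, iSup_iSup_eq_left] using this
  have hβY := (IndepFun_iff_Indep _ _ _).1 hM.indep_service
  have hXβY := (IndepFun_iff_Indep _ _ _).1 hM.indep_arrivals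
  have hβ_pair : MeasurableSpace.comap (fun ω i => β i ω) MeasurableSpace.pi ≤
      MeasurableSpace.comap (fun ω => ((fun i => β i ω), (fun t => Y t ω)))
        (MeasurableSpace.prod MeasurableSpace.pi MeasurableSpace.pi) :=
    measurable_iff_comap_le.1 (measurable_fst.comp (comap_measurable _))
  have hY_pair : MeasurableSpace.comap (fun ω t => Y t ω) MeasurableSpace.pi ≤
      MeasurableSpace.comap (fun ω => ((fun i => β i ω), (fun t => Y t ω)))
        (MeasurableSpace.prod MeasurableSpace.pi MeasurableSpace.pi) :=
    measurable_iff_comap_le.1 (measurable_snd.comp (comap_measurable _))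
  -- Each source splits into an independent past and future. Two regroupings, first of `β` with `Y`
  -- and then of `X` with both, separate the joint past from the joint future.
  have H₁ := indep_sup_sup (hβle.trans hβ₀) (hβm.trans hβ₀) (hYle.trans hY₀) (hDY.trans hY₀)
    (indep_of_indep_of_le hβY (sup_le hβle hβm) (sup_le hYle hDY)) hββ
    (hM.catastrophes.indep_past hst)
  have H₂ := indep_sup_sup (hXle.trans hX₀) (hDX.trans hX₀)
    (sup_le (hβle.trans hβ₀) (hYle.trans hY₀)) (sup_le (hβm.trans hβ₀) (hDY.trans hY₀))
    (indep_of_indep_of_le hXβY (sup_le hXle hDX)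
      (sup_le (sup_le (hβle.trans hβ_pair) (hYle.trans hY_pair))
        (sup_le (hβm.trans hβ_pair) (hDY.trans hY_pair))))
    (hM.arrivals.indep_past hst) H₁
  have mX : MeasurableSet[MeasurableSpace.comap (fun ω => X t ω - X s ω) inferInstance]
      {ω | X t ω - X s ω ∈ a} := ⟨a, MeasurableSet.of_discrete, rfl⟩
  have mY : MeasurableSet[MeasurableSpace.comap (fun ω => Y t ω - Y s ω) inferInstance]
      {ω | Y t ω - Y s ω ∈ b} := ⟨b, MeasurableSet.of_discrete, rfl⟩
  have mβ : MeasurableSet[MeasurableSpace.comap (β m) inferInstance] {ω | β m ω ∈ D} :=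
    ⟨D, hD, rfl⟩
  have mβY := MeasurableSet.inter
    (le_sup_left (b := MeasurableSpace.comap (fun ω => Y t ω - Y s ω) inferInstance) _ mβ)
    (le_sup_right (a := MeasurableSpace.comap (β m) inferInstance) _ mY)
  rw [(Indep_iff _ _ _).1 H₂ _ _ hE
      (MeasurableSet.inter (le_sup_left (a := MeasurableSpace.comap _ _) _ mX)
        (le_sup_right (a := MeasurableSpace.comap _ _) _ mβY)),
    (Indep_iff _ _ _).1 (indep_of_indep_of_le hXβY hDX
      (sup_le (hβm.trans hβ_pair) (hDY.trans hY_pair))) _ _ mX mβY,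
    (Indep_iff _ _ _).1 (indep_of_indep_of_le hβY hβm hDY) _ _ mβ mY]
  have e₁ := (hM.arrivals.law s t hst).measure_eq (p := (· ∈ a)) MeasurableSet.of_discrete
  have e₂ := (hM.catastrophes.law s t hst).measure_eq (p := (· ∈ b)) MeasurableSet.of_discrete
  have e₃ := (hM.service_law m).measure_eq (p := (· ∈ D)) hD
  rw [e₁, e₂, e₃]
  rfl

/-- The number of customers counted at time `s`, the numbers of arrivals and of catastrophes in
`(s, t]` and the service time of the next customer to arrive are independent. -/
lemma IsModel.measureReal_joint (hM : IsModel X β Y lam nu μ P) (hst : s ≤ t) (hsT : s ≤ T)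
    (d a b : Set ℕ) {D : Set ℝ} (hD : MeasurableSet D) :
    P.real {ω | numBusyUntil X β Y T s ω ∈ d ∧ X t ω - X s ω ∈ a ∧ β (X s ω) ω ∈ D ∧
        Y t ω - Y s ω ∈ b} =
      P.real {ω | numBusyUntil X β Y T s ω ∈ d} * ((poissonMeasure (lam * (t - s))).real a *
        (μ.real D * (poissonMeasure (nu * (t - s))).real b)) := by
  have hU := hM.measurable_numBusyUntil hsT
  have hX := hM.arrivals.measurable
  have hY := hM.catastrophes.measurable
  have hms : ∀ m, MeasurableSet {ω | X s ω = m ∧ numBusyUntil X β Y T s ω ∈ d} := fun m =>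
    (measurableSet_eq_fun (hX s) measurable_const).inter (hU MeasurableSet.of_discrete)
  have hdisj : Pairwise (Function.onFun Disjoint
      fun m => {ω | X s ω = m ∧ numBusyUntil X β Y T s ω ∈ d}) := by
    intro m m' hmm
    refine Set.disjoint_left.2 fun ω h h' => hmm (h.1.symm.trans h'.1)
  have h₁ : {ω | numBusyUntil X β Y T s ω ∈ d} =
      ⋃ m, {ω | X s ω = m ∧ numBusyUntil X β Y T s ω ∈ d} := by
    ext ω
    simp only [mem_iUnion, mem_ofPred_eq, exists_eq_left']
  -- On the piece `X s = m` the randomly indexed service time is `β m`; its law does not depend on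
  -- `m`, so the pieces sum to a product.
  have h₂ : {ω | numBusyUntil X β Y T s ω ∈ d ∧ X t ω - X s ω ∈ a ∧ β (X s ω) ω ∈ D ∧
        Y t ω - Y s ω ∈ b} = ⋃ m, ({ω | X s ω = m ∧ numBusyUntil X β Y T s ω ∈ d} ∩
        ({ω | X t ω - X s ω ∈ a} ∩ ({ω | β m ω ∈ D} ∩ {ω | Y t ω - Y s ω ∈ b}))) := by
    ext ω
    simp only [mem_iUnion, mem_inter_iff, mem_ofPred_eq, and_assoc, exists_eq_left']
  simp only [Measure.real, ← ENNReal.toReal_mul]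
  congr 1
  rw [h₁, h₂, measure_iUnion hdisj hms, measure_iUnion, ← ENNReal.tsum_mul_right]
  · exact tsum_congr fun m =>
      hM.measure_history_inter hst m (hM.measurableSet_history hsT m d) a b hD
  · exact fun m m' h => (hdisj h).mono inter_subset_left inter_subset_left
  · exact fun m => (hms m).inter ((((hX t).sub (hX s)) MeasurableSet.of_discrete).inter
      ((hM.service_measurable m hD).inter (((hY t).sub (hY s)) MeasurableSet.of_discrete)))

end JointLaw

/-! ### Probabilities of the elementary cases over a short interval. -/

section Estimate

/-- Follows from `1 + z ≤ exp z` and `(1 + z) * (1 - z + z ^ 2) = 1 + z ^ 3 ≥ 1`. -/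
lemma exp_neg_le_quadratic {z : ℝ} (hz : 0 ≤ z) : Real.exp (-z) ≤ 1 - z + z ^ 2 := by
  rw [Real.exp_neg]
  have h := Real.add_one_le_exp z
  refine (inv_anti₀ (by linarith) h).trans ?_
  rw [inv_le_iff_one_le_mul₀ (by linarith)]
  nlinarith [pow_nonneg hz 3]

lemma poissonMeasure_real_zero (r : ℝ≥0) : (poissonMeasure r).real {0} = Real.exp (-r) := by
  simp [poissonMeasure_real_singleton]

lemma poissonMeasure_real_one (r : ℝ≥0) : (poissonMeasure r).real {1} = r * Real.exp (-r) := by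
  simp [poissonMeasure_real_singleton, mul_comm]

lemma real_Ioi_eq (μ : Measure ℝ) [IsProbabilityMeasure μ] (c : ℝ) :
    μ.real (Ioi c) = 1 - cdf μ c := by
  rw [← compl_Iic, probReal_compl_eq_one_sub measurableSet_Iic, cdf_eq_real]

lemma real_Ioc_eq (μ : Measure ℝ) [IsProbabilityMeasure μ] {a b : ℝ} (hab : a ≤ b) :
    μ.real (Ioc a b) = cdf μ b - cdf μ a := by
  rw [cdf_eq_real, cdf_eq_real, ← measureReal_sdiff (Iic_subset_Iic.2 hab) measurableSet_Iic,
    Iic_sdiff_Iic]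

variable {Ω : Type*} [MeasurableSpace Ω] {P : Measure Ω}
  {X Y : ℝ≥0 → Ω → ℕ} {β : ℕ → Ω → ℝ} {lam nu : ℝ≥0} {μ : Measure ℝ} {s t T : ℝ≥0}

/-- The event that exactly one customer and no catastrophe arrive in `(s, t]`. -/
def singleArrival (X Y : ℝ≥0 → Ω → ℕ) (s t : ℝ≥0) : Set Ω :=
  {ω | X t ω - X s ω = 1 ∧ Y t ω - Y s ω = 0}

/-- The probability that, in case of a single arrival and no catastrophe in `(s, t]`, the number of
counted customers becomes `n` if the new customer is counted exactly when its service time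
exceeds `c`. -/
noncomputable def singleArrivalProb (x w S : ℝ) (p : ℕ → ℝ) : ℕ → ℝ
  | 0 => x * w * ((1 - S) * p 0)
  | n + 1 => x * w * ((1 - S) * p (n + 1) + S * p n)

lemma IsModel.real_noArrival (hM : IsModel X β Y lam nu μ P) (hst : s ≤ t) :
    P.real {ω | X t ω - X s ω = 0} = Real.exp (-(lam * (t - s))) := by
  have h := (hM.arrivals.law s t hst).measureReal_eq (p := (· = 0)) MeasurableSet.of_discrete
  rw [h]
  have := poissonMeasure_real_zero (lam * (t - s))
  rw [NNReal.coe_mul, NNReal.coe_sub hst] at this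
  exact this

lemma IsModel.measurableSet_singleArrival (hM : IsModel X β Y lam nu μ P) (s t : ℝ≥0) :
    MeasurableSet (singleArrival X Y s t) :=
  (measurableSet_eq_fun ((hM.arrivals.measurable t).sub (hM.arrivals.measurable s))
    measurable_const).inter (measurableSet_eq_fun ((hM.catastrophes.measurable t).sub
      (hM.catastrophes.measurable s)) measurable_const)

variable [IsProbabilityMeasure P]

lemma IsModel.real_singleArrival_inter (hM : IsModel X β Y lam nu μ P) (hst : s ≤ t) (hsT : s ≤ T)
    (d : Set ℕ) {D : Set ℝ} (hD : MeasurableSet D) :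
    P.real ({ω | numBusyUntil X β Y T s ω ∈ d ∧ β (X s ω) ω ∈ D} ∩ singleArrival X Y s t) =
      lam * (t - s) * (Real.exp (-(lam * (t - s))) * Real.exp (-(nu * (t - s)))) *
        (μ.real D * P.real {ω | numBusyUntil X β Y T s ω ∈ d}) := by
  have h := hM.measureReal_joint hst hsT d {1} {0} hD
  simp only [mem_singleton_iff, poissonMeasure_real_zero, poissonMeasure_real_one, NNReal.coe_mul,
    NNReal.coe_sub hst] at h
  have e : {ω | numBusyUntil X β Y T s ω ∈ d ∧ β (X s ω) ω ∈ D} ∩ singleArrival X Y s t =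
      {ω | numBusyUntil X β Y T s ω ∈ d ∧ X t ω - X s ω = 1 ∧ β (X s ω) ω ∈ D ∧
        Y t ω - Y s ω = 0} := by
    ext ω
    simp only [singleArrival, mem_inter_iff, mem_ofPred_eq]
    tauto
  rw [e, h]
  ring

variable [IsProbabilityMeasure μ]

lemma IsModel.real_noEvent_inter (hM : IsModel X β Y lam nu μ P) (hst : s ≤ t) (hsT : s ≤ T)
    (d : Set ℕ) :
    P.real {ω | numBusyUntil X β Y T s ω ∈ d ∧ X t ω - X s ω = 0 ∧ Y t ω - Y s ω = 0} =
      P.real {ω | numBusyUntil X β Y T s ω ∈ d} *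
        (Real.exp (-(lam * (t - s))) * Real.exp (-(nu * (t - s)))) := by
  have h := hM.measureReal_joint hst hsT d {0} {0} (MeasurableSet.univ)
  simp only [mem_singleton_iff, mem_univ, true_and, poissonMeasure_real_zero, NNReal.coe_mul,
    NNReal.coe_sub hst, probReal_univ, one_mul] at h
  exact h

open Classical in
lemma IsModel.real_next_singleArrival (hM : IsModel X β Y lam nu μ P) (hst : s ≤ t) (hsT : s ≤ T)
    (n : ℕ) (c : ℝ) :
    P.real ({ω | numBusyUntil X β Y T s ω + (if c < β (X s ω) ω then 1 else 0) = n} ∩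
        singleArrival X Y s t) =
      singleArrivalProb (lam * (t - s)) (Real.exp (-(lam * (t - s))) * Real.exp (-(nu * (t - s))))
        (1 - cdf μ c) (fun k => P.real {ω | numBusyUntil X β Y T s ω = k}) n := by
  have hle := fun k => hM.real_singleArrival_inter hst hsT {k} (measurableSet_Iic (a := c))
  have hgt := fun k => hM.real_singleArrival_inter hst hsT {k} (measurableSet_Ioi (a := c))
  simp only [mem_singleton_iff, mem_Iic, mem_Ioi, real_Ioi_eq] at hle hgt
  rw [← cdf_eq_real] at hle
  rcases n with _ | n
  · have e : {ω | numBusyUntil X β Y T s ω + (if c < β (X s ω) ω then 1 else 0) = 0} =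
        {ω | numBusyUntil X β Y T s ω = 0 ∧ β (X s ω) ω ≤ c} := by
      ext ω
      simp only [mem_ofPred_eq]
      split_ifs with h
      · simp [h]
      · simp [not_lt.1 h]
    rw [e, hle, singleArrivalProb]
    ring
  · have e : {ω | numBusyUntil X β Y T s ω + (if c < β (X s ω) ω then 1 else 0) = n + 1} =
        {ω | numBusyUntil X β Y T s ω = n + 1 ∧ β (X s ω) ω ≤ c} ∪
        {ω | numBusyUntil X β Y T s ω = n ∧ c < β (X s ω) ω} := by
      ext ω
      simp only [mem_ofPred_eq, mem_union]
      split_ifs with h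
      · simp [h]
      · simp [h, not_lt.1 h]
    rw [e, union_inter_distrib_right, measureReal_union, hle, hgt, singleArrivalProb]
    · ring
    · refine Set.disjoint_left.2 fun ω h h' => ?_
      exact absurd h'.1.2 (not_lt.2 h.1.2)
    · exact (((measurableSet_eq_fun (hM.measurable_numBusyUntil hsT) measurable_const).inter
        (measurableSet_lt measurable_const (hM.measurable_nextService s)))).inter
        (hM.measurableSet_singleArrival s t)

open Classical in
/-- In case of a single arrival and no catastrophe in `(s, t]`, replacing the arrival epoch of the
new customer by some fixed epoch in `[s, t]` changes the number of counted customers only with the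
probability that the service time falls between `T - t` and `T - s`. -/
lemma IsModel.abs_real_singleArrival_sub_le (hM : IsModel X β Y lam nu μ P) (hst : s ≤ t)
    (htT : t ≤ T) (n : ℕ) {c : ℝ} (hc : c ∈ Icc ((T : ℝ) - t) (T - s)) :
    |P.real ({ω | numBusyUntil X β Y T t ω = n} ∩ singleArrival X Y s t) -
      P.real ({ω | numBusyUntil X β Y T s ω + (if c < β (X s ω) ω then 1 else 0) = n} ∩
        singleArrival X Y s t)| ≤ lam * (t - s) * (cdf μ (T - s) - cdf μ (T - t)) := by
  have hsT := hst.trans htT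
  have hst' : (s : ℝ) ≤ t := by exact_mod_cast hst
  have hm := hM.measurableSet_singleArrival s t
  have hm₁ : MeasurableSet {ω | numBusyUntil X β Y T t ω = n} :=
    measurableSet_eq_fun (hM.measurable_numBusyUntil htT) measurable_const
  have hm₂ : MeasurableSet
      {ω | numBusyUntil X β Y T s ω + (if c < β (X s ω) ω then 1 else 0) = n} :=
    measurableSet_eq_fun ((hM.measurable_numBusyUntil hsT).add
      (Measurable.ite (measurableSet_lt measurable_const (hM.measurable_nextService s))
        measurable_const measurable_const)) measurable_const
  have h := hM.real_singleArrival_inter hst hsT univ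
    (measurableSet_Ioc (a := (T : ℝ) - t) (b := T - s))
  simp only [mem_univ, true_and, real_Ioc_eq μ (hc.1.trans hc.2), ofPred_true, probReal_univ,
    mul_one] at h
  refine (abs_measureReal_sub_le_measureReal_symmDiff (hm₁.inter hm).nullMeasurableSet
    (hm₂.inter hm).nullMeasurableSet).trans ((measureReal_mono ?_).trans (h.le.trans ?_))
  -- Both the true threshold, `T` minus the arrival epoch, and `c` lie in `[T - t, T - s]`. A
  -- service time outside `(T - t, T - s]` passes both tests or fails both.
  · have key : ∀ ω ∈ singleArrival X Y s t, β (X s ω) ω ∉ Ioc ((T : ℝ) - t) (T - s) →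
        numBusyUntil X β Y T t ω =
          numBusyUntil X β Y T s ω + (if c < β (X s ω) ω then 1 else 0) := by
      intro ω hω hβ
      have hx : X t ω = X s ω + 1 := by
        have := hω.1
        omega
      have hy : Y t ω = Y s ω :=
        le_antisymm (Nat.sub_eq_zero_iff_le.1 hω.2) (hM.catastrophes.mono ω hst)
      have h1 : (arrivalTime X (X s ω) ω : ℝ) ≤ t := by
        exact_mod_cast arrivalTime_le (X := X) (i := X s ω) (t := t) (by omega)
      have h2 : (s : ℝ) ≤ arrivalTime X (X s ω) ω := by
        exact_mod_cast le_arrivalTime (s := t) (hM.arrivals.mono ω) (by omega) le_rfl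
      rw [numBusyUntil_of_arrival (hM.arrivals.mono ω) (hM.catastrophes.mono ω) hst htT hx hy]
      congr 1
      by_cases h : (T : ℝ) - t < β (X s ω) ω
      · have h' : (T : ℝ) - s < β (X s ω) ω := by
          by_contra! h'
          exact hβ ⟨h, h'⟩
        rw [if_pos (by linarith), if_pos (hc.2.trans_lt h')]
      · push Not at h
        rw [if_neg (by linarith), if_neg (not_lt.2 (h.trans hc.1))]
    intro ω hω
    by_cases hE : ω ∈ singleArrival X Y s t
    · refine ⟨?_, hE⟩
      by_contra hβ
      have := key ω hE hβ
      rcases hω with ⟨h1, h2⟩ | ⟨h1, h2⟩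
      · exact h2 ⟨this.symm.trans h1.1, hE⟩
      · exact h2 ⟨this.trans h1.1, hE⟩
    · rcases hω with h | h
      · exact absurd h.1.2 hE
      · exact absurd h.1.2 hE
  · have h1 : 0 ≤ (lam : ℝ) * (t - s) := mul_nonneg lam.2 (by linarith)
    have h2 : 0 ≤ (nu : ℝ) * (t - s) := mul_nonneg nu.2 (by linarith)
    have h3 : 0 ≤ cdf μ (T - s) - cdf μ (T - t) :=
      sub_nonneg.2 (monotone_cdf μ (hc.1.trans hc.2))
    refine mul_le_mul_of_nonneg_right (mul_le_of_le_one_right h1 ?_) h3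
    exact mul_le_one₀ (Real.exp_le_one_iff.2 (by linarith)) (Real.exp_nonneg _)
      (Real.exp_le_one_iff.2 (by linarith))

end Estimate

/-! ### The first-order expansion of the state probabilities. -/

section Kolmogorov

/-- Here `x` and `y` are the expected numbers of arrivals and catastrophes, `e` and `w` the
probabilities of no arrival and of no event, `a` the single-arrival term and `r` the rest. Apart
from `Δ`, the error combines, with signs, at most five remainders in `[0, (x + y) ^ 2]`, whence the
factor `5`. -/
lemma abs_sub_kolmogorovRHS_le {x y e w S Δ a b r : ℝ} {p : ℕ → ℝ} (n : ℕ)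
    (hx : 0 ≤ x) (hy : 0 ≤ y) (he : e = Real.exp (-x)) (hw : w = Real.exp (-x) * Real.exp (-y))
    (hS : S ∈ Icc (0 : ℝ) 1) (hp : ∀ k, p k ∈ Icc (0 : ℝ) 1)
    (ha : |a - singleArrivalProb x w S p n| ≤ Δ)
    (hr : 0 ≤ r) (hr' : r ≤ 1 - e - x * w)
    (hb : b = p n * w + (if n = 0 then e - w else 0) + a + r) :
    |b - p n - kolmogorovRHS x y S p n| ≤ 5 * (x + y) ^ 2 + Δ := by
  have hw' : w = Real.exp (-(x + y)) := by rw [hw, ← Real.exp_add]; congr 1; ring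
  have e1 : 1 - x ≤ e := by rw [he]; linarith [Real.add_one_le_exp (-x)]
  have e2 : e ≤ 1 - x + x ^ 2 := he ▸ exp_neg_le_quadratic hx
  have w1 : 1 - (x + y) ≤ w := by rw [hw']; linarith [Real.add_one_le_exp (-(x + y))]
  have w2 : w ≤ 1 - (x + y) + (x + y) ^ 2 := hw' ▸ exp_neg_le_quadratic (add_nonneg hx hy)
  have w3 : w ≤ 1 := by rw [hw']; exact Real.exp_le_one_iff.2 (by linarith)
  have hxz : x ^ 2 ≤ (x + y) ^ 2 := by nlinarith
  have hxw₀ : 0 ≤ x * (1 - w) := mul_nonneg hx (by linarith)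
  have hxw : x * (1 - w) ≤ (x + y) ^ 2 := by
    have : x * (1 - w) ≤ x * (x + y) := mul_le_mul_of_nonneg_left (by linarith) hx
    nlinarith
  -- Since `1 - e ≤ x`, the rest is at most `x * (1 - w)`.
  have hr'' : r ≤ (x + y) ^ 2 := by linarith
  have t1 : ∀ q ∈ Icc (0 : ℝ) 1, 0 ≤ q * (w - 1 + (x + y)) ∧ q * (w - 1 + (x + y)) ≤ (x + y) ^ 2 :=
    fun q hq => ⟨mul_nonneg hq.1 (by linarith),
      (mul_le_of_le_one_left (by linarith) hq.2).trans (by linarith)⟩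
  have t2 : ∀ q ∈ Icc (0 : ℝ) 1, 0 ≤ x * (1 - w) * q ∧ x * (1 - w) * q ≤ (x + y) ^ 2 :=
    fun q hq => ⟨mul_nonneg hxw₀ hq.1, (mul_le_of_le_one_right hxw₀ hq.2).trans hxw⟩
  have hS' : 1 - S ∈ Icc (0 : ℝ) 1 := ⟨by linarith [hS.2], by linarith [hS.1]⟩
  have hmul : ∀ {u v : ℝ}, u ∈ Icc (0 : ℝ) 1 → v ∈ Icc (0 : ℝ) 1 → u * v ∈ Icc (0 : ℝ) 1 :=
    fun hu hv => unitInterval.mul_mem hu hv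
  rw [abs_le] at ha ⊢
  rcases n with _ | n
  · have h1 := t1 _ (hp 0)
    have h2 := t2 _ (hmul hS' (hp 0))
    simp only [singleArrivalProb, kolmogorovRHS, if_true] at ha hb ⊢
    constructor <;> nlinarith
  · have h1 := t1 _ (hp (n + 1))
    have h2 := t2 _ (hmul hS' (hp (n + 1)))
    have h3 := t2 _ (hmul hS (hp n))
    simp only [singleArrivalProb, kolmogorovRHS, Nat.succ_ne_zero, if_false] at ha hb ⊢
    constructor <;> nlinarith

lemma kolmogorovRHS_mul (lam nu h S : ℝ) (p : ℕ → ℝ) (n : ℕ) :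
    kolmogorovRHS (lam * h) (nu * h) S p n = h * kolmogorovRHS lam nu S p n := by
  rcases n with _ | n <;> simp only [kolmogorovRHS] <;> ring

variable {Ω : Type*} [MeasurableSpace Ω] {P : Measure Ω}
  {X Y : ℝ≥0 → Ω → ℕ} {β : ℕ → Ω → ℝ} {lam nu : ℝ≥0} {μ : Measure ℝ} {s t T : ℝ≥0}
  [IsProbabilityMeasure P] [IsProbabilityMeasure μ]

/-- The first-order expansion of the state probabilities over `(s, t]`. -/
lemma IsModel.abs_increment_sub_le (hM : IsModel X β Y lam nu μ P) (hst : s ≤ t) (htT : t ≤ T)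
    (n : ℕ) {c : ℝ} (hc : c ∈ Icc ((T : ℝ) - t) (T - s)) :
    |P.real {ω | numBusyUntil X β Y T t ω = n} - P.real {ω | numBusyUntil X β Y T s ω = n} -
      (t - s) * kolmogorovRHS lam nu (1 - cdf μ c)
        (fun k => P.real {ω | numBusyUntil X β Y T s ω = k}) n| ≤
      5 * ((lam + nu) * (t - s)) ^ 2 + lam * (t - s) * (cdf μ (T - s) - cdf μ (T - t)) := by
  have hsT := hst.trans htT
  have hst' : (s : ℝ) ≤ t := by exact_mod_cast hst
  have hXm := hM.arrivals.measurable
  have hYm := hM.catastrophes.measurable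
  have hA : MeasurableSet {ω | X t ω - X s ω = 0} :=
    measurableSet_eq_fun ((hXm t).sub (hXm s)) measurable_const
  have hB : MeasurableSet {ω | Y t ω - Y s ω = 0} :=
    measurableSet_eq_fun ((hYm t).sub (hYm s)) measurable_const
  have hE := hM.measurableSet_singleArrival s t
  have hEA : singleArrival X Y s t ⊆ {ω | X t ω - X s ω = 0}ᶜ := by
    rintro ω ⟨h, -⟩ h'
    exact one_ne_zero (h.symm.trans h')
  have hno := hM.real_noEvent_inter hst hsT {n}
  have hno' := hM.real_noEvent_inter hst hsT univ
  have hsing := hM.real_singleArrival_inter hst hsT univ MeasurableSet.univ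
  have hA' := hM.real_noArrival hst
  simp only [mem_singleton_iff, mem_univ, true_and, and_self, ofPred_true, univ_inter,
    probReal_univ, one_mul, mul_one] at hno hno' hsing
  set N : Set Ω := {ω | numBusyUntil X β Y T t ω = n} with hN
  set A : Set Ω := {ω | X t ω - X s ω = 0} with hAdef
  set B : Set Ω := {ω | Y t ω - Y s ω = 0} with hBdef
  set E : Set Ω := singleArrival X Y s t with hEdef
  have hXeq : ∀ ω ∈ A, X t ω = X s ω := fun ω h =>
    le_antisymm (Nat.sub_eq_zero_iff_le.1 h) (hM.arrivals.mono ω hst)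
  have hYeq : ∀ ω ∈ B, Y t ω = Y s ω := fun ω h =>
    le_antisymm (Nat.sub_eq_zero_iff_le.1 h) (hM.catastrophes.mono ω hst)
  have hYlt : ∀ ω ∉ B, Y s ω < Y t ω := fun ω h => Nat.sub_pos_iff_lt.1 (Nat.pos_of_ne_zero h)
  -- The four cases: no event, catastrophes without arrival, one arrival without catastrophe, and
  -- the rest.
  have s1 : P.real N = P.real (N ∩ A ∩ B) + P.real ((N ∩ A) \ B) + P.real (N ∩ E) +
      P.real ((N \ A) \ E) := by
    have h1 := measureReal_inter_add_sdiff (μ := P) (s := N) hA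
    have h2 := measureReal_inter_add_sdiff (μ := P) (s := (N ∩ A)) hB
    have h3 := measureReal_inter_add_sdiff (μ := P) (s := (N \ A)) hE
    have h4 : N \ A ∩ E = N ∩ E := by
      ext ω
      have := @hEA ω
      simp only [mem_inter_iff, mem_sdiff, mem_compl_iff] at this ⊢
      tauto
    rw [h4] at h3
    linarith
  have s2 : N ∩ A ∩ B = {ω | numBusyUntil X β Y T s ω = n ∧ X t ω - X s ω = 0 ∧
      Y t ω - Y s ω = 0} := by
    ext ω
    constructor
    · rintro ⟨⟨h1, h2⟩, h3⟩
      exact ⟨(numBusyUntil_of_no_event hst htT (hXeq ω h2) (hYeq ω h3)).symm.trans h1, h2, h3⟩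
    · rintro ⟨h1, h2, h3⟩
      exact ⟨⟨(numBusyUntil_of_no_event hst htT (hXeq ω h2) (hYeq ω h3)).trans h1, h2⟩, h3⟩
  have s3 : P.real ((N ∩ A) \ B) = if n = 0 then Real.exp (-(lam * (t - s))) -
      Real.exp (-(lam * (t - s))) * Real.exp (-(nu * (t - s))) else 0 := by
    have h0 : ∀ ω ∈ A, ω ∉ B → numBusyUntil X β Y T t ω = 0 := fun ω h h' =>
      numBusyUntil_of_catastrophe (hM.catastrophes.mono ω) htT (hXeq ω h) (hYlt ω h')
    split_ifs with hn
    · have h1 : (N ∩ A) \ B = A \ B := by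
        ext ω
        constructor
        · exact fun h => ⟨h.1.2, h.2⟩
        · exact fun h => ⟨⟨(h0 ω h.1 h.2).trans hn.symm, h.1⟩, h.2⟩
      have h2 := measureReal_inter_add_sdiff (μ := P) (s := A) hB
      have h3 : P.real (A ∩ B) = Real.exp (-(lam * (t - s))) * Real.exp (-(nu * (t - s))) := hno'
      rw [h1]
      linarith
    · have h1 : (N ∩ A) \ B = ∅ := by
        refine eq_empty_of_forall_notMem fun ω h => hn ?_
        exact h.1.1.symm.trans (h0 ω h.1.2 h.2)
      rw [h1, measureReal_empty]
  have s4 : P.real ((N \ A) \ E) ≤ 1 - Real.exp (-(lam * (t - s))) -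
      lam * (t - s) * (Real.exp (-(lam * (t - s))) * Real.exp (-(nu * (t - s)))) := by
    have h1 : P.real ((N \ A) \ E) ≤ P.real (Aᶜ \ E) :=
      measureReal_mono fun ω h => ⟨h.1.2, h.2⟩
    have h2 := measureReal_sdiff (μ := P) hEA hE
    have h3 := probReal_compl_eq_one_sub (μ := P) hA
    linarith
  have key := hM.abs_real_singleArrival_sub_le hst htT n hc
  rw [hM.real_next_singleArrival hst hsT n c] at key
  have := abs_sub_kolmogorovRHS_le (x := lam * (t - s)) (y := nu * (t - s)) (S := 1 - cdf μ c)
    (p := fun k => P.real {ω | numBusyUntil X β Y T s ω = k}) (b := P.real N) n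
    (mul_nonneg lam.2 (by linarith)) (mul_nonneg nu.2 (by linarith)) rfl rfl
    ⟨by linarith [cdf_le_one μ c], by linarith [cdf_nonneg μ c]⟩
    (fun k => ⟨measureReal_nonneg, measureReal_le_one⟩) key measureReal_nonneg s4
    (by rw [s1, s2, hno, s3])
  rwa [kolmogorovRHS_mul, ← add_mul] at this

end Kolmogorov

/-! ### From the expansion to continuity and one-sided derivatives. -/

section Derivatives

open Filter Topology

lemma hasDerivWithinAt_of_abs_sub_le {f : ℝ → ℝ} {f' x : ℝ} {S : Set ℝ} {ε : ℝ → ℝ}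
    (h : ∀ u ∈ S, |f u - f x - (u - x) * f'| ≤ ε u * |u - x|)
    (hε : Tendsto ε (𝓝[S] x) (𝓝 0)) : HasDerivWithinAt f f' S x := by
  rw [hasDerivWithinAt_iff_isLittleO, Asymptotics.isLittleO_iff]
  intro c hc
  filter_upwards [hε.eventually (gt_mem_nhds hc), self_mem_nhdsWithin] with u hu huS
  simp only [smul_eq_mul, Real.norm_eq_abs]
  exact (h u huS).trans (mul_le_mul_of_nonneg_right hu.le (abs_nonneg _))

/-- `p` has the first-order expansion on `[0, T]` prescribed by the Kolmogorov equations, with the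
service distribution function evaluated anywhere between `T - t` and `T - s`. -/
def HasKolmogorovExpansion (p : ℕ → ℝ → ℝ) (lam nu L T : ℝ) (F : ℝ → ℝ) : Prop :=
  ∀ n s t c, 0 ≤ s → s ≤ t → t ≤ T → c ∈ Icc (T - t) (T - s) →
    |p n t - p n s - (t - s) * kolmogorovRHS lam nu (1 - F c) (fun k => p k s) n| ≤
      (L * (t - s) + lam * (F (T - s) - F (T - t))) * (t - s)

variable {p : ℕ → ℝ → ℝ} {lam nu L T : ℝ} {F : ℝ → ℝ}

lemma abs_kolmogorovRHS_le (hlam : 0 ≤ lam) (hnu : 0 ≤ nu) {S : ℝ} (hS : S ∈ Icc (0 : ℝ) 1)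
    {q : ℕ → ℝ} (hq : ∀ k, q k ∈ Icc (0 : ℝ) 1) (n : ℕ) :
    |kolmogorovRHS lam nu S q n| ≤ lam + nu := by
  have hlS : lam * S ≤ lam := mul_le_of_le_one_right hlam hS.2
  have hlS' : 0 ≤ lam * S := mul_nonneg hlam hS.1
  have h1 : ∀ k, 0 ≤ (lam * S + nu) * q k := fun k => mul_nonneg (by linarith) (hq k).1
  have h2 : ∀ k, (lam * S + nu) * q k ≤ lam * S + nu :=
    fun k => mul_le_of_le_one_right (by linarith) (hq k).2
  rw [abs_le]
  rcases n with _ | n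
  · simp only [kolmogorovRHS]
    constructor <;> linarith [h1 0, h2 0]
  · have h3 : 0 ≤ lam * S * q n := mul_nonneg hlS' (hq n).1
    have h4 : lam * S * q n ≤ lam * S := mul_le_of_le_one_right hlS' (hq n).2
    simp only [kolmogorovRHS]
    constructor <;> linarith [h1 (n + 1), h2 (n + 1)]

namespace HasKolmogorovExpansion

/-- The right-hand side is bounded by `lam + nu` and the increments of `F` by `1`, so the expansion
gives a Lipschitz bound. -/
lemma continuousOn (h : HasKolmogorovExpansion p lam nu L T F)
    (hlam : 0 ≤ lam) (hnu : 0 ≤ nu) (hL : 0 ≤ L) (hF : ∀ x, F x ∈ Icc (0 : ℝ) 1)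
    (hp : ∀ k u, p k u ∈ Icc (0 : ℝ) 1) (n : ℕ) : ContinuousOn (p n) (Icc 0 T) := by
  have key : ∀ s t, 0 ≤ s → s ≤ t → t ≤ T →
      |p n t - p n s| ≤ (L * T + lam + (lam + nu)) * (t - s) := by
    intro s t hs hst htT
    have h1 := h n s t (T - t) hs hst htT ⟨le_rfl, by linarith⟩
    have h2 := abs_kolmogorovRHS_le (S := 1 - F (T - t)) (q := fun k => p k s) hlam hnu
      ⟨by linarith [(hF (T - t)).2], by linarith [(hF (T - t)).1]⟩ (fun k => hp k s) n
    have h3 : (L * (t - s) + lam * (F (T - s) - F (T - t))) * (t - s) ≤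
        (L * T + lam) * (t - s) := by
      refine mul_le_mul_of_nonneg_right (add_le_add ?_ ?_) (by linarith)
      · exact mul_le_mul_of_nonneg_left (by linarith) hL
      · exact mul_le_of_le_one_right hlam (by linarith [(hF (T - s)).2, (hF (T - t)).1])
    have h4 : |(t - s) * kolmogorovRHS lam nu (1 - F (T - t)) (fun k => p k s) n| ≤
        (lam + nu) * (t - s) := by
      rw [abs_mul, abs_of_nonneg (by linarith : 0 ≤ t - s), mul_comm]
      exact mul_le_mul_of_nonneg_right h2 (by linarith)
    have h5 := abs_add_le (p n t - p n s -
      (t - s) * kolmogorovRHS lam nu (1 - F (T - t)) (fun k => p k s) n)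
      ((t - s) * kolmogorovRHS lam nu (1 - F (T - t)) (fun k => p k s) n)
    rw [sub_add_cancel] at h5
    linarith
  rcases le_or_gt 0 T with hT | hT
  · refine (LipschitzOnWith.of_dist_le_mul (K := (L * T + lam + (lam + nu)).toNNReal)
      fun t ht s hs => ?_).continuousOn
    rw [Real.coe_toNNReal _ (by positivity), Real.dist_eq, Real.dist_eq]
    rcases le_total s t with hst | hst
    · rw [abs_of_nonneg (by linarith : 0 ≤ t - s)]
      exact key s t hs.1 hst ht.2
    · rw [abs_sub_comm, abs_sub_comm t, abs_of_nonneg (by linarith : 0 ≤ s - t)]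
      exact key t s ht.1 hst hs.2
  · simp [Icc_eq_empty_of_lt hT]

/-- The choice `c = T - t` stays fixed as `s` increases to `t`, while `T - s` decreases to `T - t`,
so right-continuity of `F` suffices. The expansion takes the state probabilities at `s`; their
continuity moves them to `t`. -/
lemma hasDerivWithinAt_left (h : HasKolmogorovExpansion p lam nu L T F)
    (hpc : ∀ n, ContinuousOn (p n) (Icc 0 T))
    (hF : ∀ x, ContinuousWithinAt F (Ici x) x) (n : ℕ) {t : ℝ} (ht : t ∈ Icc 0 T) :
    HasDerivWithinAt (p n) (kolmogorovRHS lam nu (1 - F (T - t)) (fun k => p k t) n) (Icc 0 t)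
      t := by
  have hsub : Icc 0 t ⊆ Icc 0 T := Icc_subset_Icc_right ht.2
  set R : ℝ → ℝ := fun s => kolmogorovRHS lam nu (1 - F (T - t)) (fun k => p k s) n with hR
  have hRc : ContinuousWithinAt R (Icc 0 t) t := by
    have hc := fun k => ((hpc k) t ht).mono hsub
    rcases n with _ | n
    · exact (continuousWithinAt_const.mul (hc 0)).add continuousWithinAt_const
    · exact (continuousWithinAt_const.mul (hc (n + 1))).add (continuousWithinAt_const.mul (hc n))
  have hFc : ContinuousWithinAt (fun s => F (T - s)) (Icc 0 t) t :=
    (hF (T - t)).comp (t := Ici (T - t)) (by fun_prop) fun s hs => by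
      simp only [mem_Ici]; linarith [hs.2]
  refine hasDerivWithinAt_of_abs_sub_le
    (ε := fun s => L * (t - s) + lam * (F (T - s) - F (T - t)) + |R s - R t|) (fun s hs => ?_) ?_
  · have h1 := h n s t (T - t) hs.1 hs.2 ht.2 ⟨le_rfl, by linarith [hs.2]⟩
    have hst : 0 ≤ t - s := by linarith [hs.2]
    rw [abs_sub_comm s t, abs_of_nonneg hst, add_mul]
    have h2 : p n s - p n t - (s - t) * R t =
        -(p n t - p n s - (t - s) * R s) - (R s - R t) * (t - s) := by ring
    have h3 := abs_sub (-(p n t - p n s - (t - s) * R s)) ((R s - R t) * (t - s))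
    rw [abs_neg, abs_mul, abs_of_nonneg hst, ← h2] at h3
    exact h3.trans (add_le_add h1 le_rfl)
  · have hc : ContinuousWithinAt
        (fun s => L * (t - s) + lam * (F (T - s) - F (T - t)) + |R s - R t|) (Icc 0 t) t :=
      ((by fun_prop : ContinuousWithinAt (fun s => L * (t - s)) (Icc 0 t) t).add
        (continuousWithinAt_const.mul (hFc.sub continuousWithinAt_const))).add
          (hRc.sub continuousWithinAt_const).abs
    simpa [ContinuousWithinAt] using hc

/-- Now `c = T - s`, and `T - t` tends to `T - s` from below, where a distribution function may
jump. The state probabilities already sit at the base point `s`. -/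
lemma hasDerivWithinAt_right (h : HasKolmogorovExpansion p lam nu L T F)
    (n : ℕ) {s : ℝ} (hs : s ∈ Icc 0 T) (hF : ContinuousAt F (T - s)) :
    HasDerivWithinAt (p n) (kolmogorovRHS lam nu (1 - F (T - s)) (fun k => p k s) n) (Icc s T)
      s := by
  have hFc : ContinuousWithinAt (fun t => F (T - t)) (Icc s T) s :=
    (ContinuousAt.comp (f := fun t => T - t) hF (by fun_prop)).continuousWithinAt
  refine hasDerivWithinAt_of_abs_sub_le
    (ε := fun t => L * (t - s) + lam * (F (T - s) - F (T - t))) (fun t ht => ?_) ?_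
  · rw [abs_of_nonneg (by linarith [ht.1] : 0 ≤ t - s)]
    exact h n s t (T - s) hs.1 ht.1 ht.2 ⟨by linarith [ht.1], le_rfl⟩
  · have hc : ContinuousWithinAt
        (fun t => L * (t - s) + lam * (F (T - s) - F (T - t))) (Icc s T) s :=
      (by fun_prop : ContinuousWithinAt (fun t => L * (t - s)) (Icc s T) s).add
        (continuousWithinAt_const.mul (continuousWithinAt_const.sub hFc))
    simpa [ContinuousWithinAt] using hc

end HasKolmogorovExpansion

end Derivatives

/-! ### Transfer to the conditional probabilities `busyProb`. -/

section BusyProb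

variable {Ω : Type*} {X Y : ℝ≥0 → Ω → ℕ} {β : ℕ → Ω → ℝ} {lam nu : ℝ≥0} {μ : Measure ℝ}
  {T : ℝ≥0}

lemma numBusy_zero (h : ∀ ω, X 0 ω = 0) (ω : Ω) : numBusy X β Y 0 ω = 0 := by
  simp [numBusy, customers, h]

variable [MeasurableSpace Ω] {P : Measure Ω} [IsProbabilityMeasure P]

/-- Nobody has arrived at time `0`, so the conditioning event is the whole space. -/
lemma cond_numBusy_zero (h : ∀ ω, X 0 ω = 0) : cond P {ω | numBusy X β Y 0 ω = 0} = P := by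
  simp [numBusy_zero h]

lemma busyProb_eq (h : ∀ ω, X 0 ω = 0) (n : ℕ) (t : ℝ) :
    busyProb P X β Y T n t = P.real {ω | numBusyUntil X β Y T t.toNNReal ω = n} := by
  rw [busyProb, cond_numBusy_zero h]

lemma busyProb_at_zero (h : ∀ ω, X 0 ω = 0) (n : ℕ) :
    busyProb P X β Y T n 0 = if n = 0 then 1 else 0 := by
  have h0 : ∀ ω, numBusyUntil X β Y T 0 ω = 0 := by simp [numBusyUntil, customers, h]
  rw [busyProb_eq h]
  split_ifs with hn
  · simp [h0, hn]
  · simp [h0, Ne.symm hn]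

lemma IsModel.hasKolmogorovExpansion [IsProbabilityMeasure μ] (hM : IsModel X β Y lam nu μ P)
    (T : ℝ≥0) : HasKolmogorovExpansion (busyProb P X β Y T) lam nu (5 * (lam + nu) ^ 2) T
      (cdf μ) := by
  intro n s t c hs hst htT hc
  lift s to ℝ≥0 using hs
  lift t to ℝ≥0 using s.2.trans hst
  have h := hM.abs_increment_sub_le (by exact_mod_cast hst) (by exact_mod_cast htT) n hc
  simp only [busyProb_eq hM.arrivals.zero, Real.toNNReal_coe]
  refine h.trans_eq ?_
  ring

end BusyProb

end CatastropheQueue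

theorem theorem1 {Ω : Type*} [MeasurableSpace Ω] (P : Measure Ω) [IsProbabilityMeasure P]
    (X : ℝ≥0 → Ω → ℕ) (β : ℕ → Ω → ℝ) (Y : ℝ≥0 → Ω → ℕ) (lam nu : ℝ≥0)
    (μ : Measure ℝ) [IsProbabilityMeasure μ]
    (hM : CatastropheQueue.IsModel X β Y lam nu μ P) (T : ℝ≥0) :
    -- initial conditions
    CatastropheQueue.busyProb P X β Y T 0 0 = 1 ∧
    (∀ n, 1 ≤ n → CatastropheQueue.busyProb P X β Y T n 0 = 0) ∧
    -- the equations, for every state `n`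
    (∀ n,
      ContinuousOn (CatastropheQueue.busyProb P X β Y T n) (Icc 0 (T : ℝ)) ∧
      (∀ t ∈ Icc 0 (T : ℝ), ContinuousAt (cdf μ) (T - t) →
        HasDerivWithinAt (CatastropheQueue.busyProb P X β Y T n)
          (CatastropheQueue.kolmogorovRHS lam nu (1 - cdf μ (T - t))
            (fun k => CatastropheQueue.busyProb P X β Y T k t) n) (Icc 0 (T : ℝ)) t) ∧
      (∀ t ∈ Icc 0 (T : ℝ),
        HasDerivWithinAt (CatastropheQueue.busyProb P X β Y T n)
          (CatastropheQueue.kolmogorovRHS lam nu (1 - cdf μ (T - t))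
            (fun k => CatastropheQueue.busyProb P X β Y T k t) n) (Icc 0 t) t)) ∧
    -- at the observation time itself, the probabilities are those of the number of busy servers
    (∀ n, CatastropheQueue.busyProb P X β Y T n T =
      (cond P {ω | CatastropheQueue.numBusy X β Y 0 ω = 0}).real
        {ω | CatastropheQueue.numBusy X β Y T ω = n}) := by
  have hX0 := hM.arrivals.zero
  have hexp := hM.hasKolmogorovExpansion T
  have hcont := hexp.continuousOn lam.2 nu.2 (by positivity)
    (fun x => ⟨cdf_nonneg μ x, cdf_le_one μ x⟩) (fun k u => by
      rw [CatastropheQueue.busyProb_eq hX0]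
      exact ⟨measureReal_nonneg, measureReal_le_one⟩)
  have hleft := fun n t ht => hexp.hasDerivWithinAt_left hcont (cdf μ).right_continuous n (t := t) ht
  refine ⟨?_, fun n hn => ?_, fun n => ⟨hcont n, fun t ht hF => ?_, hleft n⟩, fun n => ?_⟩
  · simp [CatastropheQueue.busyProb_at_zero hX0]
  · rw [CatastropheQueue.busyProb_at_zero hX0, if_neg (by omega)]
  -- Both one-sided derivatives have the same value, so they glue on `[0, t] ∪ [t, T]`.
  · have h := (hleft n t ht).union (hexp.hasDerivWithinAt_right n ht hF)
    rwa [Icc_union_Icc_eq_Icc ht.1 ht.2] at h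
  · rw [CatastropheQueue.busyProb, Real.toNNReal_coe]
    simp only [CatastropheQueue.numBusyUntil_self]
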